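/- Let $(W,S)$ be a Coxeter system with length function $\ell$, let $n(s,t)\in\{1,2,\dots\}\cup\{\infty\}$ be the order of $st$ for $s,t\in S$, and let $u$ be an indeterminate. The Hecke algebra $H$ of $(W,S)$ is the $\mathbb{Q}(u)$-algebra with generators $T_s$ ($s\in S$) and relations $(T_s-u^2)(T_s+1)=0$ for $s\in S$ and $T_sT_tT_s\cdots=T_tT_sT_t\cdots$ ($n(s,t)$ factors on each side) for $s,t\in S$ with $1<n(s,t)<\infty$. An $S$-labeled digraph $\Gamma$ is a directed multigraph without loops, each of whose edges is either solid or dashed and is labeled by an element of $S$, such that for every $s\in S$ every vertex occurs in exactly one edge labeled $s$. Let $M(\Gamma)$ be the $\mathbb{Q}(u)$-vector space with basis the set $V(\Gamma)$ of vertices, and for $s\in S$ let $\tau_s$ be the linear operator on $M(\Gamma)$ given, for a vertex $\alpha$ joined to $\beta$ by the edge labeled $s$ at $\alpha$, by \[ \tau_s(\alpha)=\begin{cases} \beta & \text{if the edge is solid, from } \alpha \text{ to } \beta,\\ (u^2-1)\alpha+u^2\beta & \text{if the edge is solid, from } \beta \text{ to } \alpha,\\ u\alpha+(u+1)\beta &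 \text{if the edge is dashed, from } \alpha \text{ to } \beta,\\ (u^2-u-1)\alpha+(u^2-u)\beta & \text{if the edge is dashed, from } \beta \text{ to } \alpha. \end{cases} \] $\Gamma$ is a $W$-digraph if $T_s\mapsto\tau_s$ ($s\in S$) extends to a homomorphism of $\mathbb{Q}(u)$-algebras from $H$ to the algebra of linear operators on $M(\Gamma)$. $\Gamma$ is connected if the undirected multigraph obtained by forgetting the directions, types and labels of the edges is connected. Suppose that $W$ is finite. If $\Gamma$ is a connected $W$-digraph, then $V(\Gamma)$ is finite and $|V(\Gamma)|\le|W|$. Moreover, this bound is attained: the $S$-labeled digraph with vertex set $W$ whose edges are the solid edges labeled $s$ from $x$ to $sx$, for $x\in W$ and $s\in S$ with $\ell(x)<\ell(sx)$, is a connected $W$-digraph with exactly $|W|$ vertices. -/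

import Mathlib

noncomputable section

/-- The field `ℚ(u)` of rational functions in one indeterminate. -/
abbrev Qu : Type := RatFunc ℚ

/-- The indeterminate `u` of `ℚ(u)`. -/
def Qu.u : Qu := RatFunc.X

/-- The alternating product `a b a b ⋯` with `n` factors, the first one being `a`. -/
def altProd {A : Type*} [Monoid A] : ℕ → A → A → A
  | 0, _, _ => 1
  | n + 1, a, b => a * altProd n b a

/-- Defining relations of the Hecke algebra over `ℚ(u)`: the quadratic relations and, for `s ≠ t`
with `n(s,t) < ∞`, the braid relations. The entry `0` of a `CoxeterMatrix` stands for `∞`. -/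
inductive HeckeRel {B : Type*} (M : CoxeterMatrix B) :
    FreeAlgebra Qu B → FreeAlgebra Qu B → Prop
  | quadratic (s : B) :
      HeckeRel M
        ((FreeAlgebra.ι Qu s - algebraMap Qu (FreeAlgebra Qu B) (Qu.u ^ 2)) *
          (FreeAlgebra.ι Qu s + 1)) 0
  | braid (s t : B) (hst : s ≠ t) (hfin : M s t ≠ 0) :
      HeckeRel M
        (altProd (M s t) (FreeAlgebra.ι Qu s) (FreeAlgebra.ι Qu t))
        (altProd (M s t) (FreeAlgebra.ι Qu t) (FreeAlgebra.ι Qu s))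

/-- The Hecke algebra `H` over `ℚ(u)` of the Coxeter system with Coxeter matrix `M`. -/
abbrev HeckeAlgebra {B : Type*} (M : CoxeterMatrix B) : Type _ := RingQuot (HeckeRel M)

/-- The generator `T_s` of the Hecke algebra. -/
def HeckeAlgebra.T {B : Type*} (M : CoxeterMatrix B) (s : B) : HeckeAlgebra M :=
  RingQuot.mkAlgHom Qu (HeckeRel M) (FreeAlgebra.ι Qu s)

/-- The two types of edges. -/
inductive EdgeKind : Type
  | solid
  | dashed

/-- A possible edge on the vertex set `V`, directed from `source` to `target`, solid or dashed,
and labeled by an element of `S`. -/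
@[ext]
structure LabeledEdge (S V : Type*) where
  kind : EdgeKind
  label : S
  source : V
  target : V

/-- An `S`-labeled digraph with vertex set `V`: a directed multigraph with solid or dashed edges
labeled by elements of `S`, without loops, such that for each `s` in `S` every vertex occurs in
exactly one edge labeled `s`. -/
structure SLabeledDigraph (S V : Type*) where
  edges : Set (LabeledEdge S V)
  no_loops : ∀ e ∈ edges, e.source ≠ e.target
  exists_unique_edge : ∀ (s : S) (α : V),
    ∃! e : LabeledEdge S V, e ∈ edges ∧ e.label = s ∧ (e.source = α ∨ e.target = α)

namespace SLabeledDigraph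

/-- The set of vertices of `Γ`. -/
abbrev Vertices {S V : Type*} (_Γ : SLabeledDigraph S V) : Type _ := V

/-- The simple graph underlying the undirected multigraph `Γ_undir`: distinct vertices are adjacent
when some edge, of either kind and direction and of any label, joins them. -/
def undir {S V : Type*} (Γ : SLabeledDigraph S V) : SimpleGraph V :=
  SimpleGraph.fromRel fun α β => ∃ e ∈ Γ.edges, e.source = α ∧ e.target = β

/-- `Γ` is connected if `Γ_undir` is (in particular `Γ` has a vertex). -/
def Connected {S V : Type*} (Γ : SLabeledDigraph S V) : Prop := Γ.undir.Connected

/-- The unique edge labeled `s` in which the vertex `α` occurs. -/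
def edgeAt {S V : Type*} (Γ : SLabeledDigraph S V) (s : S) (α : V) : LabeledEdge S V :=
  (Γ.exists_unique_edge s α).choose

/-- The vector space `M(Γ)` over `ℚ(u)` with basis the vertices of `Γ`. -/
abbrev Mod {S V : Type*} (_Γ : SLabeledDigraph S V) : Type _ := V →₀ Qu

open Classical in
/-- The value of `τ_s` at the basis vector `α`. -/
def tauVertex {S V : Type*} (Γ : SLabeledDigraph S V) (s : S) (α : V) : Γ.Mod :=
  if (Γ.edgeAt s α).source = α then
    match (Γ.edgeAt s α).kind with
    | .solid => Finsupp.single (Γ.edgeAt s α).target 1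
    | .dashed => Finsupp.single α Qu.u + Finsupp.single (Γ.edgeAt s α).target (Qu.u + 1)
  else
    match (Γ.edgeAt s α).kind with
    | .solid => Finsupp.single α (Qu.u ^ 2 - 1) +
        Finsupp.single (Γ.edgeAt s α).source (Qu.u ^ 2)
    | .dashed => Finsupp.single α (Qu.u ^ 2 - Qu.u - 1) +
        Finsupp.single (Γ.edgeAt s α).source (Qu.u ^ 2 - Qu.u)

/-- The linear operator `τ_s` on `M(Γ)`. -/
def tau {S V : Type*} (Γ : SLabeledDigraph S V) (s : S) : Module.End Qu Γ.Mod :=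
  Finsupp.linearCombination Qu (Γ.tauVertex s)

/-- `Γ` is a `W`-digraph, for the Coxeter system `cs` of `W`: the map `T_s ↦ τ_s` extends to a
homomorphism of `ℚ(u)`-algebras from the Hecke algebra to the linear operators on `M(Γ)`. -/
def IsWDigraph {B W V : Type*} [Group W] {M : CoxeterMatrix B} (_cs : CoxeterSystem M W)
    (Γ : SLabeledDigraph B V) : Prop :=
  ∃ ρ : HeckeAlgebra M →ₐ[Qu] Module.End Qu Γ.Mod, ∀ s : B, ρ (HeckeAlgebra.T M s) = Γ.tau s

theorem edgeAt_eq {S V : Type*} (Γ : SLabeledDigraph S V) {e : LabeledEdge S V}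
    (he : e ∈ Γ.edges) {α : V} (hα : e.source = α ∨ e.target = α) : Γ.edgeAt e.label α = e :=
  ((Γ.exists_unique_edge e.label α).choose_spec.2 e ⟨he, rfl, hα⟩).symm

/-- The four cases of the formula for `τ_s`: solid edge out of `α`, solid edge into `α`,
dashed edge out of `α`, dashed edge into `α`. -/
theorem tau_of_solid_out {S V : Type*} (Γ : SLabeledDigraph S V) {s : S} {α β : V}
    (h : ⟨.solid, s, α, β⟩ ∈ Γ.edges) :
    Γ.tau s (Finsupp.single α 1) = Finsupp.single β 1 := by
  have h1 := Γ.edgeAt_eq h (α := α) (Or.inl rfl)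
  simp only at h1
  simp [tau, tauVertex, h1]

theorem tau_of_solid_in {S V : Type*} (Γ : SLabeledDigraph S V) {s : S} {α β : V}
    (h : ⟨.solid, s, β, α⟩ ∈ Γ.edges) :
    Γ.tau s (Finsupp.single α 1) =
      (Qu.u ^ 2 - 1) • Finsupp.single α 1 + Qu.u ^ 2 • Finsupp.single β 1 := by
  have h1 := Γ.edgeAt_eq h (α := α) (Or.inr rfl)
  have h2 := Γ.no_loops _ h
  simp only at h1 h2
  simp [tau, tauVertex, h1, h2]

theorem tau_of_dashed_out {S V : Type*} (Γ : SLabeledDigraph S V) {s : S} {α β : V}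
    (h : ⟨.dashed, s, α, β⟩ ∈ Γ.edges) :
    Γ.tau s (Finsupp.single α 1) =
      Qu.u • Finsupp.single α 1 + (Qu.u + 1) • Finsupp.single β 1 := by
  have h1 := Γ.edgeAt_eq h (α := α) (Or.inl rfl)
  simp only at h1
  simp [tau, tauVertex, h1]

theorem tau_of_dashed_in {S V : Type*} (Γ : SLabeledDigraph S V) {s : S} {α β : V}
    (h : ⟨.dashed, s, β, α⟩ ∈ Γ.edges) :
    Γ.tau s (Finsupp.single α 1) =
      (Qu.u ^ 2 - Qu.u - 1) • Finsupp.single α 1 +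
        (Qu.u ^ 2 - Qu.u) • Finsupp.single β 1 := by
  have h1 := Γ.edgeAt_eq h (α := α) (Or.inr rfl)
  have h2 := Γ.no_loops _ h
  simp only at h1 h2
  simp [tau, tauVertex, h1, h2]

/-- The regular digraph of a Coxeter system: its vertices are the elements of `W`, and its edges
are the solid edges labeled `s` from `x` to `s x` with `ℓ(x) < ℓ(s x)`. -/
def regular {B W : Type*} [Group W] {M : CoxeterMatrix B} (cs : CoxeterSystem M W) :
    SLabeledDigraph B W where
  edges := {e | e.kind = .solid ∧ e.target = cs.simple e.label * e.source ∧
    cs.length e.source < cs.length (cs.simple e.label * e.source)}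
  no_loops := by
    rintro e ⟨-, h1, h2⟩ h
    rw [← h1, h] at h2
    exact lt_irrefl _ h2
  exists_unique_edge := by
    intro s x
    rcases lt_or_gt_of_ne (cs.length_simple_mul_ne x s).symm with h | h
    · refine ⟨⟨.solid, s, x, cs.simple s * x⟩, ⟨⟨rfl, rfl, h⟩, rfl, Or.inl rfl⟩, ?_⟩
      rintro ⟨k, t, a, b⟩ ⟨⟨hk, hb, hl⟩, ht, ha⟩
      simp only at hk hb hl ht ha
      subst hk ht hb
      rcases ha with rfl | rfl
      · rfl
      · rw [cs.simple_mul_simple_cancel_left] at h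
        exact absurd hl (not_lt.mpr h.le)
    · refine ⟨⟨.solid, s, cs.simple s * x, x⟩, ⟨⟨rfl, ?_, ?_⟩, rfl, Or.inr rfl⟩, ?_⟩
      · simp
      · simpa using h
      rintro ⟨k, t, a, b⟩ ⟨⟨hk, hb, hl⟩, ht, ha⟩
      simp only at hk hb hl ht ha
      subst hk ht hb
      rcases ha with rfl | rfl
      · exact absurd hl (not_lt.mpr h.le)
      · simp

end SLabeledDigraph

end

/-! In each case of the formula for τ_s, the coefficient at the other end of the edge is nonzero (1,
u², u + 1 or u² - u). A subspace stable under every τ_s therefore contains both ends of an edge or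
neither, so for connected Γ any vertex α generates M(Γ) as an H-module. By Matsumoto's theorem
(`prod_map_eq_of_isReduced`) the product of the τ_s along a reduced word depends only on the element
w of W. The quadratic relations show that the |W| vectors obtained by applying these products to α
span a stable subspace, hence all of M(Γ), and dim M(Γ) = |V(Γ)| ≤ |W|.

Matsumoto's theorem needs two facts about W, which is given by its presentation: the exchange
property, from an action on W × ℤ/2 that records parities of inversions, and that s_a s_b has order
exactly `M a b`, from a linear representation.

For the regular digraph, τ_s is left multiplication by T_s in the would-be regular representation.
These operators commute with the analogous right operators, under which the basis vector of 1
generates everything, so the braid relations need only be checked at 1. -/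

namespace CoxeterSystem

/-! ### The order of a product of two simple reflections -/

section GeometricRepresentation

variable {B : Type*} (M : CoxeterMatrix B)

/-- A square root of the eigenvalue by which `s_a s_b` acts on a vector of the plane spanned by the
simple roots `a` and `b`. -/
noncomputable def rootParam (a b : B) : ℂ :=
  if M a b = 0 then 2 else Complex.exp (Real.pi * Complex.I / M a b)

theorem rootParam_ne_zero (a b : B) : rootParam M a b ≠ 0 := by
  unfold rootParam
  split_ifs
  · norm_num
  · exact Complex.exp_ne_zero _

theorem rootParam_symm (a b : B) : rootParam M a b = rootParam M b a := by
  simp only [rootParam, M.symmetric a b]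

theorem rootParam_self (a : B) : rootParam M a a = -1 := by
  simp [rootParam, Complex.exp_pi_mul_I]

theorem rootParam_sq_isPrimitiveRoot {a b : B} (h : M a b ≠ 0) :
    IsPrimitiveRoot (rootParam M a b ^ 2) (M a b) := by
  have h1 := Complex.isPrimitiveRoot_exp (M a b) h
  rw [rootParam, if_neg h, ← Complex.exp_nat_mul]
  convert! h1 using 2
  push_cast
  ring

theorem dvd_of_rootParam_sq_pow_eq_one {a b : B} {k : ℕ} (h : (rootParam M a b ^ 2) ^ k = 1) :
    M a b ∣ k := by
  by_cases h0 : M a b = 0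
  · rw [rootParam, if_pos h0] at h
    have h1 : ((4 ^ k : ℕ) : ℂ) = ((1 : ℕ) : ℂ) := by
      push_cast
      rw [← h]
      norm_num
    have h2 : 4 ^ k = 1 := Nat.cast_injective h1
    have h3 : k = 0 := by
      by_contra hk
      exact absurd h2 (Nat.one_lt_pow hk (by norm_num)).ne'
    simp [h3]
  · exact (rootParam_sq_isPrimitiveRoot M h0).dvd_of_pow_eq_one k h

/-- The linear form on the geometric representation attached to the simple reflection `a`. -/
noncomputable def rootForm (a : B) : (B →₀ ℂ) →ₗ[ℂ] ℂ :=
  Finsupp.linearCombination ℂ fun b => rootParam M a b + (rootParam M a b)⁻¹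

/-- The action of the simple reflection `a` on the geometric representation. -/
noncomputable def rootReflection (a : B) : Module.End ℂ (B →₀ ℂ) :=
  LinearMap.id + (rootForm M a).smulRight (Finsupp.single a 1)

theorem rootReflection_apply (a : B) (v : B →₀ ℂ) :
    rootReflection M a v = v + rootForm M a v • Finsupp.single a 1 := by
  simp [rootReflection]

theorem rootForm_single (a b : B) :
    rootForm M a (Finsupp.single b 1) = rootParam M a b + (rootParam M a b)⁻¹ := by
  simp [rootForm]

theorem rootForm_single_self (a : B) : rootForm M a (Finsupp.single a 1) = -2 := by
  rw [rootForm_single, rootParam_self]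
  norm_num

theorem rootReflection_mul_self (a : B) : rootReflection M a * rootReflection M a = 1 := by
  refine LinearMap.ext fun v => ?_
  simp only [Module.End.mul_apply, rootReflection_apply, map_add, map_smul, rootForm_single_self,
    Module.End.one_apply]
  module

/-- Only z + z⁻¹ enters the two reflections, so the computation serves for `rootParam M a b` and for
its inverse. For `M a b = 0` the parameter 2 gives the eigenvalue 4, which is of infinite order. -/
theorem rootReflection_mul_apply_eigenvector {a b : B} {z : ℂ} (hz : z ≠ 0)
    (h : rootParam M a b + (rootParam M a b)⁻¹ = z + z⁻¹) :
    (rootReflection M a * rootReflection M b)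
        (Finsupp.single a 1 + z⁻¹ • Finsupp.single b 1) =
      z ^ 2 • (Finsupp.single a 1 + z⁻¹ • Finsupp.single b 1) := by
  have h' : rootParam M b a + (rootParam M b a)⁻¹ = z + z⁻¹ := by rwa [rootParam_symm]
  simp only [Module.End.mul_apply, rootReflection_apply, map_add, map_smul, rootForm_single_self]
  simp only [rootForm_single, h, h']
  match_scalars <;> field_simp <;> ring

/-- Telescoping: A^n v - v is the sum of the A^i (A v - v) for i < n. -/
theorem pow_apply_of_sub_eigenvectors {K E : Type*} [Field K] [AddCommGroup E] [Module K E]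
    (A : Module.End K E) {v x y : E} {c d : K} (hv : A v = v + x + y) (hx : A x = c • x)
    (hy : A y = d • y) (n : ℕ) :
    (A ^ n) v = v + (∑ i ∈ Finset.range n, c ^ i) • x + (∑ i ∈ Finset.range n, d ^ i) • y := by
  induction n with
  | zero => simp
  | succ n ih =>
    rw [pow_succ', Module.End.mul_apply, ih]
    simp only [map_add, map_smul, hv, hx, hy]
    rw [Finset.sum_range_succ', Finset.sum_range_succ']
    simp only [pow_succ, ← Finset.sum_mul]
    module

theorem rootReflection_isLiftable : M.IsLiftable (rootReflection M) := by
  intro a b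
  by_cases h0 : M a b = 0
  · simp [h0]
  by_cases hab : a = b
  · subst hab
    simp [rootReflection_mul_self]
  have hprim := rootParam_sq_isPrimitiveRoot M h0
  have h1 : 1 < M a b := by
    have := M.off_diagonal a b hab
    omega
  set z := rootParam M a b with hz
  have hz0 : z ≠ 0 := rootParam_ne_zero M a b
  have hzz : z - z⁻¹ ≠ 0 := by
    intro h
    apply hprim.ne_one h1
    rw [sub_eq_zero] at h
    rw [pow_two]
    nth_rewrite 2 [h]
    exact mul_inv_cancel₀ hz0
  have e1 := rootReflection_mul_apply_eigenvector M (a := a) (b := b) hz0 rfl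
  have e2 := rootReflection_mul_apply_eigenvector M (a := a) (b := b) (inv_ne_zero hz0)
    (by rw [inv_inv, add_comm])
  refine LinearMap.ext fun v => ?_
  obtain ⟨x, y, hxy⟩ : ∃ x y : ℂ, (rootReflection M a * rootReflection M b) v =
      v + x • Finsupp.single a 1 + y • Finsupp.single b 1 := by
    refine ⟨rootForm M a (v + rootForm M b v • Finsupp.single b 1), rootForm M b v, ?_⟩
    simp only [Module.End.mul_apply, rootReflection_apply]
    module
  -- The coefficient of the z⁻²-eigenvector when x e_a + y e_b is written in the two eigenvectors;
  -- then the power `M a b` only adds geometric sums over primitive roots of unity, which vanish.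
  set d := (y - x * z⁻¹) / (z - z⁻¹) with hd
  have hd' : d * (z - z⁻¹) = y - x * z⁻¹ := div_mul_cancel₀ _ hzz
  have hv : (rootReflection M a * rootReflection M b) v =
      v + (x - d) • (Finsupp.single a 1 + z⁻¹ • Finsupp.single b 1) +
        d • (Finsupp.single a 1 + z⁻¹⁻¹ • Finsupp.single b 1) := by
    rw [hxy, inv_inv]
    have : y = d * (z - z⁻¹) + x * z⁻¹ := by rw [hd']; ring
    rw [this]
    module
  rw [pow_apply_of_sub_eigenvectors _ hv (c := z ^ 2) (d := z⁻¹ ^ 2)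
    (by rw [map_smul, e1, smul_comm]) (by rw [map_smul, e2, smul_comm]),
    hprim.geom_sum_eq_zero h1]
  have h2 : IsPrimitiveRoot (z⁻¹ ^ 2) (M a b) := by
    rw [inv_pow]
    exact hprim.inv
  rw [h2.geom_sum_eq_zero h1]
  simp

end GeometricRepresentation

variable {B W : Type*} [Group W] {M : CoxeterMatrix B} (cs : CoxeterSystem M W)

theorem dvd_of_simple_mul_simple_pow_eq_one {a b : B} {k : ℕ}
    (h : (cs.simple a * cs.simple b) ^ k = 1) : M a b ∣ k := by
  by_cases hab : a = b
  · subst hab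
    simp
  have h1 := congrArg (cs.lift ⟨_, rootReflection_isLiftable M⟩) h
  simp only [map_pow, map_mul, lift_apply_simple, map_one] at h1
  have e := rootReflection_mul_apply_eigenvector M (a := a) (b := b)
    (rootParam_ne_zero M a b) rfl
  set x : B →₀ ℂ := Finsupp.single a 1 + (rootParam M a b)⁻¹ • Finsupp.single b 1 with hx
  have h2 : ∀ n, ((rootReflection M a * rootReflection M b) ^ n) x =
      (rootParam M a b ^ 2) ^ n • x := by
    intro n
    induction n with
    | zero => simp
    | succ n ih => rw [pow_succ', Module.End.mul_apply, ih, map_smul, e, smul_smul, ← pow_succ]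
  have h3 := h2 k
  rw [h1] at h3
  have h4 := DFunLike.congr_fun h3 a
  have hxa : x a = 1 := by simp [hx, Ne.symm hab]
  simp only [Module.End.one_apply, Finsupp.smul_apply, smul_eq_mul, hxa, mul_one] at h4
  exact dvd_of_rootParam_sq_pow_eq_one M h4.symm

end CoxeterSystem

namespace CoxeterSystem

variable {B W : Type*} [Group W] {M : CoxeterMatrix B} (cs : CoxeterSystem M W)

/-! ### The exchange property -/

section Exchange

open Classical in
/-- The action of the simple reflection `i` on `W × ℤ/2`: conjugation in the first coordinate,
twisted by a sign at the reflection itself. -/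
noncomputable def signedConj (i : B) : Function.End (W × ZMod 2) := fun p =>
  (cs.simple i * p.1 * cs.simple i, p.2 + if p.1 = cs.simple i then 1 else 0)

open Classical in
theorem signedConj_mul_pow_apply (i j : B) (t : W) (c : ZMod 2) (k : ℕ) :
    ((cs.signedConj i * cs.signedConj j) ^ k) (t, c) =
      ((cs.simple i * cs.simple j) ^ k * t * ((cs.simple i * cs.simple j) ^ k)⁻¹,
        c + ∑ n ∈ Finset.range (2 * k),
          if t = cs.simple j * (cs.simple i * cs.simple j) ^ n then 1 else 0) := by
  induction k with
  | zero => simp; rfl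
  | succ k ih =>
    rw [pow_succ']
    change (cs.signedConj i * cs.signedConj j)
      (((cs.signedConj i * cs.signedConj j) ^ k) (t, c)) = _
    rw [ih]
    change cs.signedConj i (cs.signedConj j _) = _
    simp only [signedConj]
    set r := cs.simple i * cs.simple j with hr
    have hj : ∀ n : ℕ, cs.simple j * r ^ n * cs.simple j = (r ^ n)⁻¹ := by
      intro n
      have h1 : cs.simple j * r * (cs.simple j)⁻¹ = r⁻¹ := by simp [hr, mul_assoc]
      have h2 := conj_pow (a := cs.simple j) (b := r) (i := n)
      rw [h1, inv_simple, inv_pow] at h2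
      exact h2.symm
    have e1 : r ^ k * t * (r ^ k)⁻¹ = cs.simple j ↔ t = cs.simple j * r ^ (2 * k) := by
      have : cs.simple j * r ^ (2 * k) = (r ^ k)⁻¹ * cs.simple j * r ^ k := by
        rw [← hj, two_mul, pow_add]
        simp [mul_assoc]
      rw [this]
      constructor
      · intro h
        rw [← h]
        group
      · rintro rfl
        group
    have e2 : cs.simple j * (r ^ k * t * (r ^ k)⁻¹) * cs.simple j = cs.simple i ↔
        t = cs.simple j * r ^ (2 * k + 1) := by
      have : cs.simple j * r ^ (2 * k + 1) =
          (r ^ k)⁻¹ * (cs.simple j * cs.simple i * cs.simple j) * r ^ k := by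
        rw [← hj, show 2 * k + 1 = k + (1 + k) by ring, pow_add, pow_add, pow_one]
        simp [hr, mul_assoc]
      rw [this]
      constructor
      · intro h
        rw [← h]
        simp [mul_assoc]
      · rintro rfl
        simp [mul_assoc]
    refine Prod.ext ?_ ?_
    · simp only [pow_succ', mul_inv_rev, mul_assoc]
      simp [hr, mul_assoc]
    · simp only [e1, e2]
      rw [show 2 * (k + 1) = 2 * k + 1 + 1 by ring, Finset.sum_range_succ, Finset.sum_range_succ]
      ring

theorem signedConj_isLiftable : M.IsLiftable cs.signedConj := by
  classical
  intro i j
  funext ⟨t, c⟩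
  rw [signedConj_mul_pow_apply, two_mul, Finset.sum_range_add]
  simp only [pow_add, simple_mul_simple_pow, one_mul]
  -- The indices n and n + `M i j` contribute equally, so the sign cancels modulo 2.
  rw [← two_mul, (by decide : (2 : ZMod 2) = 0)]
  simp
  rfl

open Classical in
-- The left side depends only on the group element, so the parity of the number of times t occurs in
-- an inversion sequence does not depend on the word.
theorem lift_signedConj_wordProd (ω : List B) (t : W) (c : ZMod 2) :
    cs.lift ⟨_, cs.signedConj_isLiftable⟩ (cs.wordProd ω) (t, c) =
      (cs.wordProd ω * t * (cs.wordProd ω)⁻¹, c + ((cs.rightInvSeq ω).count t : ℕ)) := by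
  induction ω with
  | nil => simp; rfl
  | cons i ω ih =>
    rw [wordProd_cons, map_mul, lift_apply_simple]
    refine (congrArg (cs.signedConj i) ih).trans ?_
    have e : cs.wordProd ω * t * (cs.wordProd ω)⁻¹ = cs.simple i ↔
        (cs.wordProd ω)⁻¹ * cs.simple i * cs.wordProd ω = t := by
      constructor
      · intro h
        rw [← h]
        group
      · rintro rfl
        group
    refine Prod.ext ?_ ?_
    · simp [signedConj, mul_assoc]
    · simp only [signedConj, rightInvSeq, List.count_cons, e, beq_iff_eq]
      push_cast
      ring

/-- A reduced word of w s_i followed by i is a reduced word of w whose inversion sequence contains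
s_i exactly once; by parity s_i occurs in the sequence of every word of w. -/
theorem simple_mem_rightInvSeq_of_isRightDescent {ω : List B} {i : B}
    (h : cs.IsRightDescent (cs.wordProd ω) i) : cs.simple i ∈ cs.rightInvSeq ω := by
  classical
  obtain ⟨ξ, hξ, hw⟩ := cs.exists_isReduced (cs.wordProd ω * cs.simple i)
  have hprod : cs.wordProd (ξ.concat i) = cs.wordProd ω := by
    rw [wordProd_concat, ← hw, simple_mul_simple_cancel_right]
  have hred : cs.IsReduced (ξ.concat i) := by
    unfold IsReduced
    rw [hprod, ← (cs.isRightDescent_iff.mp h), hw, hξ.eq]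
    simp
  have hcount : (cs.rightInvSeq (ξ.concat i)).count (cs.simple i) = 1 := by
    refine List.count_eq_one_of_mem hred.nodup_rightInvSeq ?_
    rw [rightInvSeq_concat]
    simp
  have h1 := cs.lift_signedConj_wordProd (ξ.concat i) (cs.simple i) 0
  rw [hprod, lift_signedConj_wordProd, hcount] at h1
  by_contra hmem
  rw [List.count_eq_zero_of_not_mem hmem] at h1
  simp at h1

theorem simple_mem_leftInvSeq_of_isLeftDescent {ω : List B} {i : B}
    (h : cs.IsLeftDescent (cs.wordProd ω) i) : cs.simple i ∈ cs.leftInvSeq ω := by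
  have h1 : cs.IsRightDescent (cs.wordProd ω.reverse) i := by
    rwa [wordProd_reverse, isRightDescent_inv_iff]
  simpa [rightInvSeq_reverse] using cs.simple_mem_rightInvSeq_of_isRightDescent h1

theorem leftInvSeq_append (ω ξ : List B) :
    cs.leftInvSeq (ω ++ ξ) =
      cs.leftInvSeq ω ++ (cs.leftInvSeq ξ).map (MulAut.conj (cs.wordProd ω)) := by
  induction ω with
  | nil => simp
  | cons i ω ih => simp [leftInvSeq, ih, wordProd_cons]

/-- If `i` is a left descent of `w t` but not of `w`, then `s_i w = w t`. -/
theorem simple_mul_eq_mul_simple {w : W} {i j : B} (h : ¬ cs.IsLeftDescent w i)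
    (h' : cs.IsLeftDescent (w * cs.simple j) i) : cs.simple i * w = w * cs.simple j := by
  obtain ⟨ω, hω, rfl⟩ := cs.exists_isReduced w
  rw [← wordProd_concat] at h'
  have h1 := cs.simple_mem_leftInvSeq_of_isLeftDescent h'
  rw [leftInvSeq_concat, List.concat_eq_append, List.mem_append, List.mem_singleton] at h1
  -- Either s_i is already a left inversion of w, which is excluded, or it is the last entry w s_j
  -- w⁻¹.
  rcases h1 with h1 | h1
  · exact absurd ((cs.isLeftInversion_simple_iff_isLeftDescent _ _).mp
      (cs.isLeftInversion_of_mem_leftInvSeq hω h1)) h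
  · rw [h1]
    group

end Exchange

/-! ### Alternating words and pairs of left descents -/

section Alternating

/-- The alternating word `a b a b ⋯` with `n` letters, the first one being `a`. -/
def altList : ℕ → B → B → List B
  | 0, _, _ => []
  | n + 1, a, b => a :: altList n b a

theorem length_altList (n : ℕ) (a b : B) : (altList n a b).length = n := by
  induction n generalizing a b with
  | zero => rfl
  | succ n ih => simp [altList, ih]

theorem prod_map_altList {A : Type*} [Monoid A] (f : B → A) (n : ℕ) (a b : B) :
    ((altList n a b).map f).prod = altProd n (f a) (f b) := by
  induction n generalizing a b with
  | zero => rfl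
  | succ n ih => simp [altList, altProd, ih]

theorem wordProd_altList (n : ℕ) (a b : B) :
    cs.wordProd (altList n a b) = altProd n (cs.simple a) (cs.simple b) :=
  prod_map_altList _ _ _ _

theorem altProd_simple_eq_pow_mul (n : ℕ) (a b : B) :
    altProd n (cs.simple a) (cs.simple b) =
      (cs.simple a * cs.simple b) ^ n * altProd n (cs.simple b) (cs.simple a) := by
  induction n generalizing a b with
  | zero => simp [altProd]
  | succ n ih =>
    have h1 : (cs.simple a * cs.simple b) ^ n =
        cs.simple a * (cs.simple b * cs.simple a) ^ n * (cs.simple a)⁻¹ := by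
      rw [← conj_pow]
      simp [mul_assoc]
    rw [altProd, altProd, ih b a, pow_succ, h1]
    simp [mul_assoc]

theorem altProd_simple_comm (a b : B) :
    altProd (M a b) (cs.simple a) (cs.simple b) =
      altProd (M a b) (cs.simple b) (cs.simple a) := by
  rw [altProd_simple_eq_pow_mul, simple_mul_simple_pow, one_mul]

theorem exists_eq_pow_mul_of_mem_leftInvSeq_altList {n : ℕ} {a b : B} {t : W}
    (h : t ∈ cs.leftInvSeq (altList n a b)) :
    ∃ l < n, t = (cs.simple a * cs.simple b) ^ l * cs.simple a := by
  induction n generalizing a b t with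
  | zero => simp [altList] at h
  | succ n ih =>
    simp only [altList, leftInvSeq, List.mem_cons, List.mem_map] at h
    rcases h with rfl | ⟨x, hx, rfl⟩
    · exact ⟨0, by omega, by simp⟩
    · obtain ⟨l, hl, rfl⟩ := ih hx
      refine ⟨l + 1, by omega, ?_⟩
      have h1 : (cs.simple a * cs.simple b) ^ l =
          cs.simple a * (cs.simple b * cs.simple a) ^ l * (cs.simple a)⁻¹ := by
        rw [← conj_pow]
        simp [mul_assoc]
      rw [pow_succ, h1]
      simp [mul_assoc]

/-- The exact order of s_a s_b enters here: s_b = (s_a s_b)^l s_a would give (s_a s_b)^(l+1) = 1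
with l + 1 ≤ n. -/
theorem simple_notMem_leftInvSeq_altList {n : ℕ} {a b : B} (hn : n < M a b ∨ M a b = 0) :
    cs.simple b ∉ cs.leftInvSeq (altList n a b) := by
  intro h
  obtain ⟨l, hl, h⟩ := cs.exists_eq_pow_mul_of_mem_leftInvSeq_altList h
  have h1 : (cs.simple a * cs.simple b) ^ (l + 1) = 1 := by
    rw [pow_succ, ← mul_assoc, ← h, simple_mul_simple_self]
  have h2 := cs.dvd_of_simple_mul_simple_pow_eq_one h1
  rcases hn with hn | hn
  · have := Nat.le_of_dvd (by omega) h2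
    omega
  · simp [hn] at h2

theorem length_altProd_simple {n : ℕ} {a b : B} (hn : n ≤ M a b ∨ M a b = 0) :
    cs.length (altProd n (cs.simple a) (cs.simple b)) = n := by
  induction n generalizing a b with
  | zero => simp [altProd]
  | succ n ih =>
    rw [M.symmetric a b] at hn
    rw [altProd, ← wordProd_altList, cs.not_isLeftDescent_iff.mp fun h =>
      cs.simple_notMem_leftInvSeq_altList (n := n) (a := b) (b := a) (by omega)
        (cs.simple_mem_leftInvSeq_of_isLeftDescent h), wordProd_altList, ih (by omega)]

/-- If `b` is a left descent of an element starting with `a b a ⋯`, with fewer than `M a b`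
factors, then the element starts with `b a b ⋯`, with one more factor. -/
theorem exists_eq_altProd_succ_mul {n : ℕ} {a b : B} {x : W} (hn : n < M a b ∨ M a b = 0)
    (h : cs.IsLeftDescent (altProd n (cs.simple a) (cs.simple b) * x) b) :
    ∃ y, altProd n (cs.simple a) (cs.simple b) * x =
      altProd (n + 1) (cs.simple b) (cs.simple a) * y ∧ cs.length y < cs.length x := by
  obtain ⟨ξ, hξ, rfl⟩ := cs.exists_isReduced x
  rw [← wordProd_altList, ← wordProd_append] at h
  have h1 := cs.simple_mem_leftInvSeq_of_isLeftDescent h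
  rw [leftInvSeq_append, List.mem_append, List.mem_map] at h1
  obtain ⟨t, ht, h1⟩ := h1.resolve_left (cs.simple_notMem_leftInvSeq_altList hn)
  rw [MulAut.conj_apply, wordProd_altList] at h1
  -- With p the alternating product, s_b = p t p⁻¹, hence p x = (p t)(t x) = s_b p (t x), and t x is
  -- shorter than x because t is a left inversion of x.
  refine ⟨t * cs.wordProd ξ, ?_, (cs.isLeftInversion_of_mem_leftInvSeq hξ ht).2⟩
  have h2 := (cs.isReflection_of_mem_leftInvSeq ξ ht).mul_self
  have h3 : altProd n (cs.simple a) (cs.simple b) * t =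
      cs.simple b * altProd n (cs.simple a) (cs.simple b) :=
    mul_inv_eq_iff_eq_mul.mp h1
  rw [altProd, ← h3]
  simp only [mul_assoc]
  rw [← mul_assoc t t, h2, one_mul]

/-- The two descents are used in turn, each adding one letter to the alternating prefix and
shortening the remaining factor. -/
theorem exists_eq_altProd_mul {w : W} {n : ℕ} {a b : B} (hn : n ≤ M a b ∨ M a b = 0)
    (ha : cs.IsLeftDescent w a) (hb : cs.IsLeftDescent w b) :
    ∃ y, w = altProd n (cs.simple a) (cs.simple b) * y ∧ cs.length y + n ≤ cs.length w := by
  induction n generalizing a b with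
  | zero => exact ⟨w, by simp [altProd], by simp⟩
  | succ n ih =>
    rw [M.symmetric a b] at hn
    obtain ⟨x, hx, hl⟩ := ih (a := b) (b := a) (by omega) hb ha
    obtain ⟨y, hy, hl'⟩ := cs.exists_eq_altProd_succ_mul (n := n) (a := b) (b := a) (x := x)
      (by omega) (hx ▸ ha)
    exact ⟨y, hx.trans hy, by omega⟩

/-- Otherwise w would have alternating prefixes of every length, even beyond ℓ(w). -/
theorem ne_zero_of_isLeftDescent {w : W} {a b : B}
    (ha : cs.IsLeftDescent w a) (hb : cs.IsLeftDescent w b) : M a b ≠ 0 := by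
  intro h
  obtain ⟨y, -, hy⟩ := cs.exists_eq_altProd_mul (n := cs.length w + 1) (Or.inr h) ha hb
  omega

end Alternating

/-! ### Matsumoto's theorem -/

/-- A map of `B` to a monoid satisfies the braid relations of the Coxeter matrix `M`. -/
def _root_.CoxeterMatrix.SatisfiesBraid {A : Type*} [Monoid A] (M : CoxeterMatrix B) (f : B → A) :
    Prop :=
  ∀ a b, a ≠ b → M a b ≠ 0 → altProd (M a b) (f a) (f b) = altProd (M a b) (f b) (f a)

/-- **Matsumoto's theorem**. -/
theorem prod_map_eq_of_isReduced {A : Type*} [Monoid A] {f : B → A} (hf : M.SatisfiesBraid f)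
    {ω ξ : List B} (hω : cs.IsReduced ω) (hξ : cs.IsReduced ξ)
    (h : cs.wordProd ω = cs.wordProd ξ) : (ω.map f).prod = (ξ.map f).prod := by
  induction hn : ω.length using Nat.strong_induction_on generalizing ω ξ with
  | _ n ih =>
  have hlen : ω.length = ξ.length := by rw [← hω.eq, ← hξ.eq, h]
  rcases ω with _ | ⟨a, ω⟩
  · rw [List.length_nil, eq_comm, List.length_eq_zero_iff] at hlen
    rw [hlen]
  rcases ξ with _ | ⟨b, ξ⟩
  · simp at hlen
  have tail : ∀ {c : B} {ω₁ : List B}, cs.IsReduced (c :: ω₁) → cs.IsReduced ω₁ :=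
    fun h1 => h1.drop 1
  have cancel : ∀ {c : B} {ω₁ ω₂ : List B}, cs.IsReduced (c :: ω₁) → cs.IsReduced (c :: ω₂) →
      cs.wordProd (c :: ω₁) = cs.wordProd (c :: ω₂) → (c :: ω₁).length = n →
      ((c :: ω₁).map f).prod = ((c :: ω₂).map f).prod := by
    intro c ω₁ ω₂ h1 h2 h3 h4
    simp only [List.map_cons, List.prod_cons]
    rw [wordProd_cons, wordProd_cons, mul_right_inj] at h3
    rw [ih ω₁.length (by simp at h4; omega) (tail h1) (tail h2) h3 rfl]
  by_cases hab : a = b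
  · subst hab
    exact cancel hω hξ h hn
  have descent : ∀ {c : B} {ω₁ : List B}, cs.IsReduced (c :: ω₁) →
      cs.IsLeftDescent (cs.wordProd (c :: ω₁)) c := by
    intro c ω₁ h1
    unfold IsLeftDescent
    rw [h1.eq, wordProd_cons, simple_mul_simple_cancel_left, (tail h1).eq]
    simp
  have ha := descent hω
  have hb := descent hξ
  rw [← h] at hb
  have hM := cs.ne_zero_of_isLeftDescent ha hb
  obtain ⟨y, hy, hl⟩ := cs.exists_eq_altProd_mul (Or.inl le_rfl) ha hb
  obtain ⟨υ, hυ, rfl⟩ := cs.exists_isReduced y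
  rw [hυ.eq, hω.eq] at hl
  -- When the first letters differ, two intermediate words are used, starting with the long
  -- alternating words in a and b. Each shares its first letter with one of the given words, and a
  -- braid relation connects them.
  have wa : cs.wordProd (altList (M a b) a b ++ υ) = cs.wordProd (a :: ω) := by
    rw [wordProd_append, wordProd_altList, hy]
  have wb : cs.wordProd (altList (M a b) b a ++ υ) = cs.wordProd (a :: ω) := by
    rw [wordProd_append, wordProd_altList, ← altProd_simple_comm, hy]
  have red : ∀ {c d : B}, cs.wordProd (altList (M a b) c d ++ υ) = cs.wordProd (a :: ω) →
      cs.IsReduced (altList (M a b) c d ++ υ) ∧ (altList (M a b) c d ++ υ).length = n := by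
    intro c d h1
    have h2 := cs.length_wordProd_le (altList (M a b) c d ++ υ)
    have h3 : (altList (M a b) c d ++ υ).length = M a b + υ.length := by
      rw [List.length_append, length_altList]
    unfold IsReduced
    rw [h1, hω.eq] at h2 ⊢
    omega
  obtain ⟨ra, la⟩ := red wa
  obtain ⟨rb, lb⟩ := red wb
  have hbraid : ((altList (M a b) a b ++ υ).map f).prod =
      ((altList (M a b) b a ++ υ).map f).prod := by
    simp only [List.map_append, List.prod_append, prod_map_altList, hf a b hab hM]
  -- Written as a successor, `M a b` lets `altList` unfold to a word with a visible first letter, as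
  -- `cancel` requires.
  obtain ⟨m, hm⟩ := Nat.exists_eq_succ_of_ne_zero hM
  rw [hm] at wa wb ra rb la lb hbraid
  calc ((a :: ω).map f).prod = ((altList (m + 1) a b ++ υ).map f).prod :=
        cancel hω ra wa.symm hn
    _ = ((altList (m + 1) b a ++ υ).map f).prod := hbraid
    _ = ((b :: ξ).map f).prod := cancel rb hξ (wb.trans h) lb

end CoxeterSystem

/-! ### Cyclic modules over Hecke algebras -/

namespace CoxeterSystem

variable {B W : Type*} [Group W] {M : CoxeterMatrix B}

/-- A cyclic module over a Hecke algebra (of arbitrary parameters) of a finite Coxeter group has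
dimension at most the order of the group. -/
theorem finite_and_finrank_le_of_cyclic (cs : CoxeterSystem M W) [Finite W] {K E : Type*} [Field K] [AddCommGroup E]
    [Module K E] {f : B → Module.End K E} (hf : M.SatisfiesBraid f)
    (hq : ∀ s, ∃ c d : K, f s * f s = c • f s + d • 1) {v : E}
    (hv : ∀ N : Submodule K E, v ∈ N → (∀ s, ∀ x ∈ N, f s x ∈ N) → N = ⊤) :
    Module.Finite K E ∧ Module.finrank K E ≤ Nat.card W := by
  have := Fintype.ofFinite W
  choose red hred hprod using cs.exists_isReduced
  set g : W → E := fun w => ((red w).map f).prod v with hg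
  have hup : ∀ (s : B) (w : W), ¬ cs.IsLeftDescent w s → f s (g w) = g (cs.simple s * w) := by
    intro s w h
    have h1 : cs.wordProd (s :: red w) = cs.simple s * w := by
      rw [wordProd_cons, ← hprod]
    have h2 : cs.IsReduced (s :: red w) := by
      unfold IsReduced
      rw [h1, cs.not_isLeftDescent_iff.mp h, List.length_cons, ← (hred w).eq, ← hprod]
    have h3 := cs.prod_map_eq_of_isReduced hf h2 (hred (cs.simple s * w)) (by rw [h1, ← hprod])
    simp only [hg, ← h3, List.map_cons, List.prod_cons, Module.End.mul_apply]
  have htop : Submodule.span K (Set.range g) = ⊤ := by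
    apply hv
    · refine Submodule.subset_span ⟨1, ?_⟩
      have h1 := (hred 1).eq
      rw [← hprod, length_one, eq_comm, List.length_eq_zero_iff] at h1
      simp [hg, h1]
    · intro s x hx
      induction hx using Submodule.span_induction with
      | zero => simp
      | add x y _ _ hx hy => rw [map_add]; exact Submodule.add_mem _ hx hy
      | smul a x _ hx => rw [map_smul]; exact Submodule.smul_mem _ _ hx
      | mem x hx =>
        obtain ⟨w, rfl⟩ := hx
        by_cases h : cs.IsLeftDescent w s
        · have h1 := hup s (cs.simple s * w) (cs.isLeftDescent_iff_not_isLeftDescent_mul.mp h)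
          rw [simple_mul_simple_cancel_left] at h1
          obtain ⟨c, d, hcd⟩ := hq s
          have h2 := LinearMap.congr_fun hcd (g (cs.simple s * w))
          simp only [Module.End.mul_apply, LinearMap.add_apply, LinearMap.smul_apply,
            Module.End.one_apply, h1] at h2
          rw [h2]
          exact Submodule.add_mem _ (Submodule.smul_mem _ _ (Submodule.subset_span ⟨w, rfl⟩))
            (Submodule.smul_mem _ _ (Submodule.subset_span ⟨_, rfl⟩))
        · rw [hup s w h]
          exact Submodule.subset_span ⟨_, rfl⟩
  refine ⟨⟨⟨(Set.finite_range g).toFinset, by rw [Set.Finite.coe_toFinset, htop]⟩⟩, ?_⟩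
  rw [← finrank_top, ← htop, Nat.card_eq_fintype_card]
  exact finrank_range_le_card g

end CoxeterSystem

/-! ### Relations in the Hecke algebra -/

theorem map_altProd {A A' F : Type*} [Monoid A] [Monoid A'] [FunLike F A A']
    [MonoidHomClass F A A'] (φ : F) (n : ℕ) (a b : A) :
    φ (altProd n a b) = altProd n (φ a) (φ b) := by
  induction n generalizing a b with
  | zero => simp [altProd]
  | succ n ih => simp [altProd, ih]

theorem sub_algebraMap_mul_add_one_eq_zero_iff {R A : Type*} [CommRing R] [Ring A] [Algebra R A]
    {x : A} {c : R} :
    (x - algebraMap R A c) * (x + 1) = 0 ↔ x * x = (c - 1) • x + c • 1 := by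
  rw [Algebra.algebraMap_eq_smul_one, mul_add, sub_mul, mul_one, smul_mul_assoc, one_mul,
    ← sub_eq_zero (a := x * x), sub_smul, one_smul]
  refine Eq.congr ?_ rfl
  abel

theorem Qu.u_ne_zero : Qu.u ≠ 0 := RatFunc.X_ne_zero

theorem Qu.u_ne_C (c : ℚ) : Qu.u ≠ RatFunc.C c := by
  rw [Qu.u, ← RatFunc.algebraMap_X, ← RatFunc.algebraMap_C]
  intro h
  exact Polynomial.X_ne_C c (RatFunc.algebraMap_injective ℚ h)

theorem Qu.u_add_one_ne_zero : Qu.u + 1 ≠ 0 := by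
  intro h
  apply Qu.u_ne_C (-1)
  rw [map_neg, map_one]
  exact eq_neg_of_add_eq_zero_left h

theorem Qu.u_sq_sub_u_ne_zero : Qu.u ^ 2 - Qu.u ≠ 0 := by
  rw [show Qu.u ^ 2 - Qu.u = Qu.u * (Qu.u - 1) by ring]
  refine mul_ne_zero Qu.u_ne_zero (sub_ne_zero.mpr ?_)
  simpa using Qu.u_ne_C 1

namespace HeckeAlgebra

variable {B : Type*} (M : CoxeterMatrix B)

theorem satisfiesBraid_T : M.SatisfiesBraid (HeckeAlgebra.T M) := by
  intro a b hab h
  have h1 := RingQuot.mkAlgHom_rel Qu (HeckeRel.braid (M := M) a b hab h)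
  rwa [map_altProd, map_altProd] at h1

theorem T_quadratic (s : B) :
    (T M s - algebraMap Qu (HeckeAlgebra M) (Qu.u ^ 2)) * (T M s + 1) = 0 := by
  have h1 := RingQuot.mkAlgHom_rel Qu (HeckeRel.quadratic (M := M) s)
  rwa [map_mul, map_sub, map_add, map_one, map_zero, AlgHom.commutes] at h1

end HeckeAlgebra

/-! ### The bound for connected W-digraphs -/

namespace SLabeledDigraph

variable {B W V : Type*} [Group W] {M : CoxeterMatrix B} {cs : CoxeterSystem M W}
  {Γ : SLabeledDigraph B V}

theorem IsWDigraph.satisfiesBraid (h : Γ.IsWDigraph cs) : M.SatisfiesBraid Γ.tau := by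
  obtain ⟨ρ, hρ⟩ := h
  intro a b hab hM
  have h1 := congrArg ρ (HeckeAlgebra.satisfiesBraid_T M a b hab hM)
  simpa only [map_altProd, hρ] using h1

theorem IsWDigraph.tau_mul_self (h : Γ.IsWDigraph cs) (s : B) :
    Γ.tau s * Γ.tau s = (Qu.u ^ 2 - 1) • Γ.tau s + Qu.u ^ 2 • 1 := by
  obtain ⟨ρ, hρ⟩ := h
  have h1 := congrArg ρ (HeckeAlgebra.T_quadratic M s)
  rw [map_mul, map_sub, map_add, map_one, map_zero, AlgHom.commutes, hρ] at h1
  exact (sub_algebraMap_mul_add_one_eq_zero_iff (R := Qu) (A := Module.End Qu (V →₀ Qu))).mp h1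

theorem single_mem_iff_of_edge (N : Submodule Qu Γ.Mod) (hN : ∀ s, ∀ x ∈ N, Γ.tau s x ∈ N)
    {e : LabeledEdge B V} (he : e ∈ Γ.edges) :
    Finsupp.single e.source 1 ∈ N ↔ Finsupp.single e.target 1 ∈ N := by
  have cancel : ∀ {c d : Qu} {x y : Γ.Mod}, d ≠ 0 → c • x + d • y ∈ N → x ∈ N → y ∈ N := by
    intro c d x y hd h hx
    exact (N.smul_mem_iff hd).mp ((N.add_mem_iff_right (N.smul_mem c hx)).mp h)
  obtain ⟨k, s, α, β⟩ := e
  cases k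
  · constructor <;> intro h
    · simpa only [Γ.tau_of_solid_out he] using hN s _ h
    · have h1 := hN s _ h
      rw [Γ.tau_of_solid_in he] at h1
      exact cancel (pow_ne_zero 2 Qu.u_ne_zero) h1 h
  · constructor <;> intro h <;> have h1 := hN s _ h
    · rw [Γ.tau_of_dashed_out he] at h1
      exact cancel Qu.u_add_one_ne_zero h1 h
    · rw [Γ.tau_of_dashed_in he] at h1
      exact cancel Qu.u_sq_sub_u_ne_zero h1 h

theorem Connected.eq_top_of_single_mem (h : Γ.Connected) {N : Submodule Qu Γ.Mod}
    (hN : ∀ s, ∀ x ∈ N, Γ.tau s x ∈ N) {α : V} (hα : Finsupp.single α 1 ∈ N) : N = ⊤ := by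
  have hadj : ∀ β γ, Γ.undir.Adj β γ → Finsupp.single β 1 ∈ N → Finsupp.single γ 1 ∈ N := by
    rintro β γ ⟨-, ⟨e, he, rfl, rfl⟩ | ⟨e, he, rfl, rfl⟩⟩ hβ
    · exact (single_mem_iff_of_edge N hN he).mp hβ
    · exact (single_mem_iff_of_edge N hN he).mpr hβ
  have hwalk : ∀ β γ (p : Γ.undir.Walk β γ), Finsupp.single β 1 ∈ N → Finsupp.single γ 1 ∈ N := by
    intro β γ p
    induction p with
    | nil => exact id
    | cons h1 _ ih => exact fun h2 => ih (hadj _ _ h1 h2)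
  rw [eq_top_iff]
  intro x _
  rw [← Finsupp.sum_single x]
  refine Submodule.sum_mem _ fun β _ => ?_
  obtain ⟨p⟩ := h.preconnected α β
  rw [← mul_one (x β), ← smul_eq_mul, ← Finsupp.smul_single]
  exact N.smul_mem _ (hwalk α β p hα)

theorem IsWDigraph.finite_and_card_le [Finite W] (h : Γ.IsWDigraph cs) (hc : Γ.Connected) :
    Finite V ∧ Nat.card V ≤ Nat.card W := by
  obtain ⟨α⟩ := hc.nonempty
  obtain ⟨h1, h2⟩ := cs.finite_and_finrank_le_of_cyclic h.satisfiesBraid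
    (fun s => ⟨_, _, h.tau_mul_self s⟩) (v := Finsupp.single α 1)
    (fun N hN hN' => hc.eq_top_of_single_mem hN' hN)
  have hV : Finite V := Module.Finite.finite_basis (Finsupp.basisSingleOne (R := Qu) (ι := V))
  have := Fintype.ofFinite V
  refine ⟨hV, ?_⟩
  rwa [Module.finrank_finsupp_self, ← Nat.card_eq_fintype_card] at h2

end SLabeledDigraph

namespace CoxeterSystem

/-! ### The regular representation -/

section RegularRepresentation

variable {B W : Type*} [Group W] {M : CoxeterMatrix B} (cs : CoxeterSystem M W)
  {K : Type*} [Field K] (q : K)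

open Classical in
/-- The operator of the left regular representation of the Hecke algebra with parameter `q`
attached to a simple reflection. -/
noncomputable def heckeLeft (s : B) : Module.End K (W →₀ K) :=
  Finsupp.linearCombination K fun w =>
    (if cs.IsLeftDescent w s then q - 1 else 0) • Finsupp.single w 1 +
      (if cs.IsLeftDescent w s then q else 1) • Finsupp.single (cs.simple s * w) 1

open Classical in
/-- The operator of the right regular representation of the Hecke algebra with parameter `q`
attached to a simple reflection. -/
noncomputable def heckeRight (s : B) : Module.End K (W →₀ K) :=
  Finsupp.linearCombination K fun w =>
    (if cs.IsRightDescent w s then q - 1 else 0) • Finsupp.single w 1 +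
      (if cs.IsRightDescent w s then q else 1) • Finsupp.single (w * cs.simple s) 1

open Classical in
theorem heckeLeft_single (s : B) (w : W) : cs.heckeLeft q s (Finsupp.single w 1) =
    (if cs.IsLeftDescent w s then q - 1 else 0) • Finsupp.single w 1 +
      (if cs.IsLeftDescent w s then q else 1) • Finsupp.single (cs.simple s * w) 1 := by
  simp [heckeLeft]

open Classical in
theorem heckeRight_single (s : B) (w : W) : cs.heckeRight q s (Finsupp.single w 1) =
    (if cs.IsRightDescent w s then q - 1 else 0) • Finsupp.single w 1 +
      (if cs.IsRightDescent w s then q else 1) • Finsupp.single (w * cs.simple s) 1 := by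
  simp [heckeRight]

theorem heckeLeft_single_of_not_isLeftDescent {s : B} {w : W} (h : ¬ cs.IsLeftDescent w s) :
    cs.heckeLeft q s (Finsupp.single w 1) = Finsupp.single (cs.simple s * w) 1 := by
  simp [heckeLeft_single, h]

theorem heckeRight_single_of_not_isRightDescent {s : B} {w : W}
    (h : ¬ cs.IsRightDescent w s) :
    cs.heckeRight q s (Finsupp.single w 1) = Finsupp.single (w * cs.simple s) 1 := by
  simp [heckeRight_single, h]

theorem heckeLeft_mul_self (s : B) :
    cs.heckeLeft q s * cs.heckeLeft q s = (q - 1) • cs.heckeLeft q s + q • 1 := by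
  refine Finsupp.lhom_ext' fun w => LinearMap.ext_ring ?_
  have h := cs.isLeftDescent_iff_not_isLeftDescent_mul (w := w) (i := s)
  simp only [LinearMap.comp_apply, Finsupp.lsingle_apply, Module.End.mul_apply,
    LinearMap.add_apply, LinearMap.smul_apply, Module.End.one_apply]
  by_cases h1 : cs.IsLeftDescent w s
  · have h2 := h.mp h1
    simp only [heckeLeft_single, h1, h2, map_add, map_smul, simple_mul_simple_cancel_left, if_true,
      if_false]
    module
  · have h2 : cs.IsLeftDescent (cs.simple s * w) s := by tauto
    simp only [heckeLeft_single, h1, h2, map_add, map_smul, simple_mul_simple_cancel_left, if_true,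
      if_false]
    module

theorem isLeftDescent_mul_iff_or {w : W} {s t : B} :
    (cs.IsLeftDescent (w * cs.simple t) s ↔ cs.IsLeftDescent w s) ∨
      cs.simple s * w = w * cs.simple t := by
  by_cases h : cs.IsLeftDescent w s <;> by_cases h' : cs.IsLeftDescent (w * cs.simple t) s
  · tauto
  · right
    have h1 := cs.simple_mul_eq_mul_simple (j := t) h' (by rwa [simple_mul_simple_cancel_right])
    rw [simple_mul_simple_cancel_right] at h1
    nth_rewrite 1 [← h1]
    rw [simple_mul_simple_cancel_left]
  · exact Or.inr (cs.simple_mul_eq_mul_simple h h')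
  · tauto

/-- By `isLeftDescent_mul_iff_or`, either the two multiplications do not affect each other's
descents and both composites expand alike, or s w = w t and the two operators agree on the basis
vectors of w and w t. -/
theorem commute_heckeLeft_heckeRight (s t : B) :
    Commute (cs.heckeLeft q s) (cs.heckeRight q t) := by
  refine Finsupp.lhom_ext' fun w => LinearMap.ext_ring ?_
  simp only [LinearMap.comp_apply, Finsupp.lsingle_apply, Module.End.mul_apply]
  rcases cs.isLeftDescent_mul_iff_or (w := w) (s := s) (t := t) with h | h
  · have h' : cs.IsRightDescent (cs.simple s * w) t ↔ cs.IsRightDescent w t := by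
      simp only [isLeftDescent_iff, isRightDescent_iff, ← mul_assoc] at h ⊢
      have h1 := cs.length_simple_mul w s
      have h2 := cs.length_mul_simple w t
      have h3 := cs.length_mul_simple (cs.simple s * w) t
      have h4 := cs.length_simple_mul (w * cs.simple t) s
      rw [← mul_assoc] at h4
      omega
    by_cases h1 : cs.IsLeftDescent w s <;> by_cases h2 : cs.IsRightDescent w t <;>
      simp only [h1, h2, iff_true, iff_false] at h h' <;>
      simp only [heckeLeft_single, heckeRight_single, map_add, map_smul, h, h', h1, h2, mul_assoc,
        if_true, if_false] <;>
      module
  · have e : cs.IsRightDescent w t ↔ cs.IsLeftDescent w s := by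
      simp only [IsRightDescent, IsLeftDescent, h]
    have e1 : cs.simple s * (w * cs.simple t) = w := by
      rw [← h, simple_mul_simple_cancel_left]
    have e' : cs.IsRightDescent (w * cs.simple t) t ↔ cs.IsLeftDescent (w * cs.simple t) s := by
      simp only [IsRightDescent, IsLeftDescent, simple_mul_simple_cancel_right, e1]
    have h1 : cs.heckeRight q t (Finsupp.single w 1) = cs.heckeLeft q s (Finsupp.single w 1) := by
      rw [heckeLeft_single, heckeRight_single, h, propext e]
    have h2 : cs.heckeRight q t (Finsupp.single (w * cs.simple t) 1) =
        cs.heckeLeft q s (Finsupp.single (w * cs.simple t) 1) := by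
      rw [heckeLeft_single, heckeRight_single, e1, propext e', simple_mul_simple_cancel_right]
    rw [h1, heckeLeft_single, h]
    simp only [map_add, map_smul, h1, h2]

/-- If t is a right descent of w, the right operator of t carries the basis vector of w t to that of
w; induction on length reaches every basis vector from that of 1. -/
theorem end_eq_of_commute_heckeRight {F G : Module.End K (W →₀ K)}
    (hF : ∀ t, Commute F (cs.heckeRight q t)) (hG : ∀ t, Commute G (cs.heckeRight q t))
    (h : F (Finsupp.single 1 1) = G (Finsupp.single 1 1)) : F = G := by
  refine Finsupp.lhom_ext' fun w => LinearMap.ext_ring ?_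
  simp only [LinearMap.comp_apply, Finsupp.lsingle_apply]
  induction hn : cs.length w using Nat.strong_induction_on generalizing w with
  | _ n ih =>
  by_cases hw : w = 1
  · rw [hw, h]
  obtain ⟨t, ht⟩ := cs.exists_rightDescent_of_ne_one hw
  have h1 := cs.heckeRight_single_of_not_isRightDescent q
    (cs.isRightDescent_iff_not_isRightDescent_mul.mp ht)
  rw [simple_mul_simple_cancel_right] at h1
  rw [← h1, ← Module.End.mul_apply, ← Module.End.mul_apply, (hF t).eq, (hG t).eq,
    Module.End.mul_apply, Module.End.mul_apply, ih _ (hn ▸ ht) _ rfl]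

theorem commute_altProd {A : Type*} [Monoid A] {a b c : A} (ha : Commute a c) (hb : Commute b c)
    (n : ℕ) : Commute (altProd n a b) c := by
  induction n generalizing a b with
  | zero => exact Commute.one_left c
  | succ n ih => exact ha.mul_left (ih hb ha)

/-- Up to n letters every factor raises the length (`length_altProd_simple`), so each operator
merely multiplies the basis element. -/
theorem altProd_heckeLeft_single_one {n : ℕ} {a b : B} (hn : n ≤ M a b ∨ M a b = 0) :
    altProd n (cs.heckeLeft q a) (cs.heckeLeft q b) (Finsupp.single 1 1) =
      Finsupp.single (altProd n (cs.simple a) (cs.simple b)) 1 := by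
  induction n generalizing a b with
  | zero => simp [altProd]
  | succ n ih =>
    have hn' : n + 1 ≤ M b a ∨ M b a = 0 := by rwa [M.symmetric b a]
    have hl := cs.length_altProd_simple hn
    rw [altProd] at hl
    rw [altProd, Module.End.mul_apply, ih (by omega), heckeLeft_single_of_not_isLeftDescent, altProd]
    rw [not_isLeftDescent_iff, hl, cs.length_altProd_simple (by omega)]

theorem satisfiesBraid_heckeLeft : M.SatisfiesBraid (cs.heckeLeft q) := by
  intro a b _ _
  refine cs.end_eq_of_commute_heckeRight q
    (fun t => commute_altProd (cs.commute_heckeLeft_heckeRight q a t)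
      (cs.commute_heckeLeft_heckeRight q b t) _)
    (fun t => commute_altProd (cs.commute_heckeLeft_heckeRight q b t)
      (cs.commute_heckeLeft_heckeRight q a t) _) ?_
  rw [altProd_heckeLeft_single_one _ _ (Or.inl le_rfl),
    altProd_heckeLeft_single_one _ _ (Or.inl (M.symmetric a b).le), altProd_simple_comm]

end RegularRepresentation

end CoxeterSystem

/-! ### The regular digraph -/

namespace SLabeledDigraph

variable {B W : Type*} [Group W] {M : CoxeterMatrix B} (cs : CoxeterSystem M W)

theorem tau_regular (s : B) : (regular cs).tau s = cs.heckeLeft (Qu.u ^ 2) s := by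
  refine Finsupp.lhom_ext' fun w => LinearMap.ext_ring ?_
  simp only [LinearMap.comp_apply, Finsupp.lsingle_apply]
  by_cases h : cs.IsLeftDescent w s
  · have he : (⟨.solid, s, cs.simple s * w, w⟩ : LabeledEdge B W) ∈ (regular cs).edges :=
      ⟨rfl, by simp, by simpa [CoxeterSystem.IsLeftDescent] using h⟩
    rw [tau_of_solid_in _ he, cs.heckeLeft_single]
    simp only [h, if_true]
  · have he : (⟨.solid, s, w, cs.simple s * w⟩ : LabeledEdge B W) ∈ (regular cs).edges :=
      ⟨rfl, rfl, by simp [cs.not_isLeftDescent_iff.mp h]⟩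
    rw [tau_of_solid_out _ he, cs.heckeLeft_single_of_not_isLeftDescent _ h]

theorem isWDigraph_of_relations {V : Type*} {Γ : SLabeledDigraph B V}
    (hb : M.SatisfiesBraid Γ.tau)
    (hq : ∀ s, Γ.tau s * Γ.tau s = (Qu.u ^ 2 - 1) • Γ.tau s + Qu.u ^ 2 • 1) :
    Γ.IsWDigraph cs := by
  have hrel : ∀ ⦃x y : FreeAlgebra Qu B⦄, HeckeRel M x y →
      FreeAlgebra.lift Qu Γ.tau x = FreeAlgebra.lift Qu Γ.tau y := by
    intro x y h
    cases h with
    | quadratic s =>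
      rw [map_mul, map_sub, map_add, map_one, map_zero, AlgHom.commutes, FreeAlgebra.lift_ι_apply]
      exact (sub_algebraMap_mul_add_one_eq_zero_iff (R := Qu) (A := Module.End Qu (V →₀ Qu))).mpr (hq s)
    | braid s t hst hM =>
      simpa only [map_altProd, FreeAlgebra.lift_ι_apply] using hb s t hst hM
  refine ⟨RingQuot.liftAlgHom Qu ⟨FreeAlgebra.lift Qu Γ.tau, hrel⟩, fun s => ?_⟩
  rw [HeckeAlgebra.T, RingQuot.liftAlgHom_mkAlgHom_apply, FreeAlgebra.lift_ι_apply]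

theorem isWDigraph_regular : (regular cs).IsWDigraph cs := by
  have h : (regular cs).tau = cs.heckeLeft (Qu.u ^ 2) := funext (tau_regular cs)
  refine isWDigraph_of_relations cs ?_ fun s => ?_
  · rw [h]
    exact cs.satisfiesBraid_heckeLeft _
  · rw [h]
    exact cs.heckeLeft_mul_self _ s

theorem connected_regular : (regular cs).Connected := by
  have hadj : ∀ s w, (regular cs).undir.Adj w (cs.simple s * w) := by
    intro s w
    refine (SimpleGraph.fromRel_adj _ _ _).mpr ⟨fun h => cs.length_simple_mul_ne w s
      (congrArg cs.length h).symm, ?_⟩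
    rcases lt_or_gt_of_ne (cs.length_simple_mul_ne w s) with h | h
    · exact Or.inr ⟨⟨.solid, s, cs.simple s * w, w⟩, ⟨rfl, by simp, by simpa using h⟩, rfl, rfl⟩
    · exact Or.inl ⟨⟨.solid, s, w, cs.simple s * w⟩, ⟨rfl, rfl, h⟩, rfl, rfl⟩
  have hone : ∀ w, (regular cs).undir.Reachable 1 w := fun w =>
    cs.simple_induction_left w (SimpleGraph.Reachable.refl _)
      fun w s h => h.trans (hadj s w).reachable
  exact (SimpleGraph.connected_iff _).mpr ⟨fun x y => (hone x).symm.trans (hone y), ⟨1⟩⟩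

end SLabeledDigraph

theorem corollary7 {B W : Type*} [Group W] {M : CoxeterMatrix B}
    (cs : CoxeterSystem M W) [Finite W] :
    (∀ {V : Type*} (Γ : SLabeledDigraph B V), Γ.IsWDigraph cs → Γ.Connected →
      Finite Γ.Vertices ∧ Nat.card Γ.Vertices ≤ Nat.card W) ∧
    ((SLabeledDigraph.regular cs).IsWDigraph cs ∧
      (SLabeledDigraph.regular cs).Connected ∧
      Nat.card (SLabeledDigraph.regular cs).Vertices = Nat.card W) :=
  ⟨fun _ h hc => h.finite_and_card_le hc, SLabeledDigraph.isWDigraph_regular cs,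
    SLabeledDigraph.connected_regular cs, rfl⟩
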